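/- \textbf{Lemma (General Sparsification).} For a finite simple graph $G$ let $t(G)$ be its number of triangles, and let $\Delta_E$ be the maximum, over the edges $(u,v)\in E(G)$, of the number of triangles of $G$ that contain the edge $(u,v)$ (with $\Delta_E=0$ if $G$ has no edge). For pairwise disjoint $A,B,C\subseteq V(G)$ let $t(A,B,C)$ be the number of triangles of the graph obtained from the subgraph of $G$ induced on $A\cup B\cup C$ by deleting all edges with both endpoints in $A$, in $B$, or in $C$. There is an absolute constant $\kappa_1>0$ such that the following holds for all integers $k\ge 1$ and $d\ge 0$ and for every finite simple graph $G$ on $n\ge 1$ vertices with $\Delta_E\le d$. Assign to each vertex of $G$ one of the colours $1,\dots,3k$, independently and uniformly at random, and let $V_j$ be the set of vertices of colour $j$, for $1\le j\le 3k$. Then $$\mathbb{P}\left(\left|\frac{9k^2}{2}\sum_{i=1}^{k}t(V_i,V_{k+i},V_{2k+i})-t(G)\right|>\kappa_1\,d\,k^2\sqrt{t(G)}\,\log n\right)\le\frac{2}{n^4}.$$ -/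

import Mathlib

open scoped BigOperators

namespace TriangleSparsification

/-- `t(G)`: the number of triangles of a (finite) graph. -/
noncomputable def triangleCount {V : Type*} (G : SimpleGraph V) : ℕ :=
  (G.cliqueSet 3).ncard

/-- `Δ_e`: the number of triangles of `G` that contain both endpoints of `e`. -/
noncomputable def edgeTriangleCount {V : Type*} (G : SimpleGraph V) (e : Sym2 V) : ℕ :=
  {s ∈ G.cliqueSet 3 | ∀ v ∈ e, v ∈ s}.ncard

/-- `Δ_E`: the maximum of `Δ_e` over the edges of a finite graph (it is `0` if there are no
edges). -/
noncomputable def maxEdgeTriangleCount {V : Type*} (G : SimpleGraph V) : ℕ :=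
  ⨆ e : G.edgeSet, edgeTriangleCount G e

/-- `G(A, B, C)`: the subgraph of `G` induced on `A ∪ B ∪ C`, minus the edges with both endpoints
in `A`, in `B` or in `C`. The vertices outside `A ∪ B ∪ C` are kept as isolated vertices. -/
def tripartiteSubgraph {V : Type*} (G : SimpleGraph V) (A B C : Set V) : SimpleGraph V where
  Adj u v := G.Adj u v ∧ u ∈ A ∪ B ∪ C ∧ v ∈ A ∪ B ∪ C ∧
    ¬(u ∈ A ∧ v ∈ A) ∧ ¬(u ∈ B ∧ v ∈ B) ∧ ¬(u ∈ C ∧ v ∈ C)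
  symm := ⟨fun _ _ h => ⟨h.1.symm, h.2.2.1, h.2.1, fun g => h.2.2.2.1 g.symm,
    fun g => h.2.2.2.2.1 g.symm, fun g => h.2.2.2.2.2 g.symm⟩⟩
  loopless := ⟨fun _ h => h.1.ne rfl⟩

/-- `t(A, B, C)`: the number of triangles of `G(A, B, C)`. -/
noncomputable def tripartiteTriangleCount {V : Type*} (G : SimpleGraph V) (A B C : Set V) : ℕ :=
  triangleCount (tripartiteSubgraph G A B C)

/-- The law of a colouring of `V` with `m` colours in which every vertex gets a colour
independently and uniformly at random. -/
noncomputable def coloringMeasure (V : Type*) [Fintype V] (m : ℕ) :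
    MeasureTheory.Measure (V → Fin m) :=
  MeasureTheory.Measure.pi fun _ => ProbabilityTheory.uniformOn (Set.univ : Set (Fin m))

/-- The part of the partition that consists of the vertices of colour `j`
(the colours are numbered `0, …, m - 1`). -/
def colorClass {V : Type*} {m : ℕ} (c : V → Fin m) (j : ℕ) : Set V :=
  {v | (c v : ℕ) = j}

/-- `∑ᵢ t(Vᵢ, V_{k+i}, V_{2k+i})` for the partition of the vertices given by a colouring with
`3k` colours. -/
noncomputable def sparsifiedCount {V : Type*} (G : SimpleGraph V) (k : ℕ)
    (c : V → Fin (3 * k)) : ℕ :=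
  ∑ i ∈ Finset.range k,
    tripartiteTriangleCount G (colorClass c i) (colorClass c (k + i)) (colorClass c (2 * k + i))

end TriangleSparsification

/-! A triangle is counted by the sparsified sum exactly when its three colours are distinct and
congruent modulo `k`, so the sum is Z = ∑ `rainbowIndicator` over triangles, with mean 2t/(9k²). It
remains to show that Z has exponential tails on the scale √(dt).

A bounded-difference inequality applied to Z itself would lose too much, since recolouring one
vertex can affect all triangles through it. Instead `sq_expect_exp_half_le` bounds the exponential
moment of Z by a weighted sum of exponential moments of (Z - E_v Z)², where E_v averages over the
colour of v alone. With the colour of v fixed, Z - E_v Z has mean zero, because the chance that a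
triangle is rainbow does not depend on the colour of one vertex. Recolouring another vertex a moves
it by at most twice the codegree of a and v. Codegrees are at most d and sum to 2 deg(v), where
deg(v) counts triangles at v, so `expect_exp_le_of_dependsOn` makes the deviation subgaussian with
parameter 8d·deg(v). By `expect_exp_mul_sq_le` its square then has a bounded exponential moment at
scale 1/(d·deg(v)). Weights nearly proportional to deg(v) balance all vertices at once, and Markov's
inequality finishes. -/

namespace TriangleSparsification

/-! ### Exponential moments of functions of independent coordinates. -/

section Averaging

open Finset Function

theorem convexOn_map_expect_le {ι : Type*} [Fintype ι] [Nonempty ι] {s : Set ℝ} {φ : ℝ → ℝ}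
    (hφ : ConvexOn ℝ s φ) (x : ι → ℝ) (hx : ∀ i, x i ∈ s) : φ (𝔼 i, x i) ≤ 𝔼 i, φ (x i) := by
  have hcard : (Fintype.card ι : ℝ) ≠ 0 := by exact_mod_cast Fintype.card_ne_zero
  have h := hφ.map_sum_le (t := univ) (w := fun _ => (Fintype.card ι : ℝ)⁻¹) (p := x)
    (fun _ _ => by positivity) (by simp [hcard]) (fun i _ => hx i)
  simp only [smul_eq_mul, ← mul_sum] at h
  rw [Fintype.expect_eq_sum_div_card, Fintype.expect_eq_sum_div_card, div_eq_inv_mul,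
    div_eq_inv_mul]
  exact h

/-- For |x| ≤ 1 use exp x ≤ 1 + x + x². For x > 1 compare exponents, and for x < -1 use exp x ≤ 1
and x + x² ≥ 0. The linear term disappears after averaging a centred variable. -/
theorem exp_le_add_exp_sq (x : ℝ) : Real.exp x ≤ x + Real.exp (x ^ 2) := by
  have hsq : x ^ 2 + 1 ≤ Real.exp (x ^ 2) := Real.add_one_le_exp _
  by_cases hx : |x| ≤ 1
  · have := (abs_le.1 (Real.abs_exp_sub_one_sub_id_le hx)).2
    linarith
  · rcases lt_abs.1 (not_le.1 hx) with h | h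
    · have : Real.exp x ≤ Real.exp (x ^ 2) := Real.exp_le_exp.2 (by nlinarith)
      linarith
    · have : Real.exp x ≤ 1 := Real.exp_le_one_iff.2 (by linarith)
      nlinarith

/-- If the averages of `x` vanish, the exponential moment is controlled by the square. -/
theorem expect_exp_le_expect_exp_sq {ι : Type*} [Fintype ι] (x : ι → ℝ) (hx : 𝔼 i, x i = 0) :
    𝔼 i, Real.exp (x i) ≤ 𝔼 i, Real.exp (x i ^ 2) := by
  calc 𝔼 i, Real.exp (x i) ≤ 𝔼 i, (x i + Real.exp (x i ^ 2)) :=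
        expect_le_expect fun i _ => exp_le_add_exp_sq _
    _ = 𝔼 i, Real.exp (x i ^ 2) := by rw [expect_add_distrib, hx, zero_add]

variable {V C : Type*} [DecidableEq V]

theorem dependsOn_update {u : V} {S : Finset V} (hu : u ∉ S) {f : (V → C) → ℝ}
    (hf : DependsOn f (S : Set V)) (c : V → C) (j : C) : f (update c u j) = f c :=
  hf fun i hi => by
    rw [update_of_ne]
    rintro rfl
    exact hu hi

variable [Fintype C]

/-- The average of `f` over a uniformly random new value of the coordinate `v`. -/
noncomputable def resample (v : V) (f : (V → C) → ℝ) (c : V → C) : ℝ :=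
  𝔼 j, f (update c v j)

theorem resample_update (v : V) (f : (V → C) → ℝ) (c : V → C) (j : C) :
    resample v f (update c v j) = resample v f c := by
  simp [resample]

theorem resample_comm (u v : V) (f : (V → C) → ℝ) :
    resample u (resample v f) = resample v (resample u f) := by
  rcases eq_or_ne u v with rfl | h
  · rfl
  · funext c
    simp only [resample]
    rw [expect_comm]
    simp only [update_comm h]

theorem resample_sub (v : V) (f g : (V → C) → ℝ) (c : V → C) :
    resample v (fun c => f c - g c) c = resample v f c - resample v g c :=
  expect_sub_distrib _ _ _

theorem resample_const_mul (v : V) (a : ℝ) (f : (V → C) → ℝ) (c : V → C) :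
    resample v (fun c => a * f c) c = a * resample v f c :=
  (mul_expect _ _ _).symm

theorem resample_sum {ι : Type*} (v : V) (s : Finset ι) (f : ι → (V → C) → ℝ) (c : V → C) :
    resample v (fun c => ∑ i ∈ s, f i c) c = ∑ i ∈ s, resample v (f i) c :=
  expect_sum_comm _ _ _

theorem resample_of_update_eq [Nonempty C] {v : V} {g : (V → C) → ℝ}
    (hg : ∀ c j, g (update c v j) = g c) (c : V → C) : resample v g c = g c := by
  simp [resample, hg]

theorem resample_mul_left {v : V} {g : (V → C) → ℝ} (hg : ∀ c j, g (update c v j) = g c)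
    (f : (V → C) → ℝ) (c : V → C) :
    resample v (fun c => g c * f c) c = g c * resample v f c := by
  simp only [resample, hg]
  exact (mul_expect _ _ _).symm

theorem convexOn_map_resample_le [Nonempty C] {s : Set ℝ} {φ : ℝ → ℝ} (hφ : ConvexOn ℝ s φ)
    (v : V) (f : (V → C) → ℝ) (hf : ∀ c, f c ∈ s) (c : V → C) :
    φ (resample v f c) ≤ resample v (fun c => φ (f c)) c :=
  convexOn_map_expect_le hφ _ fun _ => hf _

theorem dependsOn_resample {u : V} {S : Finset V} {f : (V → C) → ℝ}
    (hf : DependsOn f (insert u S : Finset V)) : DependsOn (resample u f) (S : Set V) := by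
  intro x y hxy
  refine expect_congr rfl fun j _ => hf fun i hi => ?_
  rcases eq_or_ne i u with rfl | h
  · simp
  · simp only [coe_insert, Set.mem_insert_iff, h, false_or] at hi
    simp [h, hxy i hi]

variable [Fintype V]

theorem expect_resample [Nonempty C] (v : V) (f : (V → C) → ℝ) :
    𝔼 c, resample v f c = 𝔼 c, f c := by
  -- Exchanging the value at `v` with the fresh sample is an involution of the product.
  have h : 𝔼 p : (V → C) × C, f (update p.1 v p.2) = 𝔼 p : (V → C) × C, f p.1 := by
    refine expect_nbij' (fun p => (update p.1 v p.2, p.1 v)) (fun p => (update p.1 v p.2, p.1 v))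
      ?_ ?_ ?_ ?_ ?_ <;> simp
  have h₁ := expect_product' (univ : Finset (V → C)) (univ : Finset C)
    (fun c j => f (update c v j))
  have h₂ := expect_product' (univ : Finset (V → C)) (univ : Finset C) (fun c _ => f c)
  rw [univ_product_univ] at h₁ h₂
  simp only [resample]
  rw [← h₁, h, h₂]
  simp

/-- A weak form of McDiarmid's inequality. -/
theorem expect_exp_le_of_dependsOn [Nonempty C] (b : V → ℝ) (S : Finset V) :
    ∀ f : (V → C) → ℝ, DependsOn f (S : Set V) →
      (∀ v ∈ S, ∀ c j, |f (update c v j) - f c| ≤ b v) →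
      𝔼 c, Real.exp (f c) ≤ Real.exp (𝔼 c, f c + ∑ v ∈ S, b v ^ 2) := by
  induction S using Finset.induction_on with
  | empty =>
    intro f hf _
    obtain ⟨c₀⟩ : Nonempty (V → C) := inferInstance
    have : ∀ c, f c = f c₀ := fun c => (by simpa using hf : DependsOn f ∅).empty c c₀
    simp [this]
  | insert u S hu ih =>
    intro f hf hb
    -- Average out `u` first: the centred fluctuation in `u` costs exp(b u²), and the remaining
    -- function `resample u f` keeps the oscillation bounds in the other coordinates.
    have key : ∀ c, resample u (fun c => Real.exp (f c)) c
        ≤ Real.exp (resample u f c) * Real.exp (b u ^ 2) := by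
      intro c
      have h1 : 𝔼 j, (f (update c u j) - resample u f c) = 0 := by
        rw [expect_sub_distrib, Fintype.expect_const]
        exact sub_self _
      have h2 : ∀ j, |f (update c u j) - resample u f c| ≤ b u := by
        intro j
        rw [resample, ← Fintype.expect_const (ι := C) (f (update c u j)), ← expect_sub_distrib]
        refine (abs_expect_le _ _).trans (expect_le univ_nonempty fun i _ => ?_)
        simpa using hb u (mem_insert_self _ _) (update c u i) j
      have h3 := expect_exp_le_expect_exp_sq _ h1
      have h4 : 𝔼 j, Real.exp ((f (update c u j) - resample u f c) ^ 2) ≤ Real.exp (b u ^ 2) :=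
        expect_le univ_nonempty fun j _ => Real.exp_le_exp.2 (sq_le_sq' (abs_le.1 (h2 j)).1
          (abs_le.1 (h2 j)).2)
      have h5 : resample u (fun c => Real.exp (f c)) c = Real.exp (resample u f c) *
          𝔼 j, Real.exp (f (update c u j) - resample u f c) := by
        rw [mul_expect]
        simp only [resample, ← Real.exp_add]
        exact expect_congr rfl fun j _ => by congr 1; ring
      rw [h5]
      exact mul_le_mul_of_nonneg_left (h3.trans h4) (Real.exp_pos _).le
    have hosc : ∀ v ∈ S, ∀ c j, |resample u f (update c v j) - resample u f c| ≤ b v := by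
      intro v hv c j
      have huv : v ≠ u := by rintro rfl; exact hu hv
      rw [resample, resample, ← expect_sub_distrib]
      refine (abs_expect_le _ _).trans (expect_le univ_nonempty fun i _ => ?_)
      rw [update_comm huv]
      exact hb v (mem_insert_of_mem hv) _ _
    calc 𝔼 c, Real.exp (f c) = 𝔼 c, resample u (fun c => Real.exp (f c)) c :=
          (expect_resample u _).symm
      _ ≤ 𝔼 c, Real.exp (resample u f c) * Real.exp (b u ^ 2) :=
          expect_le_expect fun c _ => key c
      _ = (𝔼 c, Real.exp (resample u f c)) * Real.exp (b u ^ 2) := (expect_mul _ _ _).symm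
      _ ≤ Real.exp (𝔼 c, resample u f c + ∑ v ∈ S, b v ^ 2) * Real.exp (b u ^ 2) :=
          mul_le_mul_of_nonneg_right (ih _ (dependsOn_resample hf) hosc) (Real.exp_pos _).le
      _ = _ := by
          rw [expect_resample, ← Real.exp_add, sum_insert hu]
          congr 1
          ring

/-- The logarithmic increments `L v` compensate the exponential of `f - 𝔼 f`. -/
theorem exists_compensator [Nonempty C] (S : Finset V) :
    ∀ f : (V → C) → ℝ, DependsOn f (S : Set V) →
      ∃ L : V → (V → C) → ℝ, (∀ v ∈ S, DependsOn (L v) (S : Set V)) ∧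
        𝔼 c, Real.exp (f c - 𝔼 c, f c - ∑ v ∈ S, L v c) ≤ 1 ∧
        ∀ v ∈ S, ∀ N : ℝ, 1 ≤ N →
          𝔼 c, Real.exp (N * L v c) ≤ 𝔼 c, Real.exp (N * (f c - resample v f c) ^ 2) := by
  induction S using Finset.induction_on with
  | empty =>
    intro f hf
    refine ⟨fun _ _ => 0, by simp, ?_, by simp⟩
    obtain ⟨c₀⟩ : Nonempty (V → C) := inferInstance
    have : ∀ c, f c = f c₀ := fun c => (by simpa using hf : DependsOn f ∅).empty c c₀
    simp [this]
  | insert u S hu ih =>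
    intro f hf
    have hAf := dependsOn_resample hf
    obtain ⟨L, hL, hexp, hN⟩ := ih _ hAf
    -- `log X` is the conditional log-moment of the martingale increment at `u`; the other
    -- compensators come from `resample u f`.
    set X : (V → C) → ℝ := resample u (fun c => Real.exp (f c - resample u f c)) with hX
    have hXpos : ∀ c, 0 < X c := fun c =>
      expect_pos (fun _ _ => Real.exp_pos _) univ_nonempty
    have hne : ∀ v ∈ S, v ≠ u := by rintro v hv rfl; exact hu hv
    have hsub : (S : Set V) ⊆ (insert u S : Finset V) := by simp
    refine ⟨fun v => if v = u then fun c => Real.log (X c) else L v, ?_, ?_, ?_⟩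
    · intro v hv
      rcases mem_insert.1 hv with rfl | hv
      · simp only [if_true]
        have : DependsOn X (S : Set V) := by
          refine dependsOn_resample fun x y hxy => ?_
          rw [hf hxy, hAf fun i hi => hxy i (hsub hi)]
        intro x y hxy
        simp only
        rw [this fun i hi => hxy i (hsub hi)]
      · simp only [if_neg (hne v hv)]
        exact (hL v hv).mono hsub
    · set g : (V → C) → ℝ := fun c =>
        Real.exp (resample u f c - 𝔼 c, f c - ∑ v ∈ S, L v c) / X c with hg
      -- The dependence clause of the induction enters here: the earlier `L v` ignore `u`, so `g`
      -- factors out of the average over `u`.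
      have hgu : ∀ c j, g (update c u j) = g c := by
        intro c j
        simp only [hg, hX, resample_update]
        rw [sum_congr rfl fun v hv => dependsOn_update hu (hL v hv) c j]
      have h1 : ∀ c, Real.exp (f c - 𝔼 c, f c - ∑ v ∈ insert u S,
          (if v = u then fun c => Real.log (X c) else L v) c)
          = g c * Real.exp (f c - resample u f c) := by
        intro c
        rw [sum_insert hu, sum_congr rfl fun v hv => by rw [if_neg (hne v hv)]]
        simp only [if_true, hg]
        rw [div_mul_eq_mul_div, ← Real.exp_add, eq_div_iff (hXpos c).ne']
        nth_rw 2 [← Real.exp_log (hXpos c)]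
        rw [← Real.exp_add]
        congr 1
        ring
      rw [expect_congr rfl fun c _ => h1 c, ← expect_resample u]
      refine le_trans (le_of_eq ?_) hexp
      refine expect_congr rfl fun c _ => ?_
      rw [resample_mul_left hgu, expect_resample]
      exact div_mul_cancel₀ _ (hXpos c).ne'
    · intro v hv N hN1
      rcases mem_insert.1 hv with rfl | hv
      · simp only [if_true]
        rw [← expect_resample v (fun c => Real.exp (N * (f c - resample v f c) ^ 2))]
        refine expect_le_expect fun c _ => ?_
        have h1 : 𝔼 j, (f (update c v j) - resample v f (update c v j)) = 0 := by
          simp only [resample_update]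
          rw [expect_sub_distrib, Fintype.expect_const]
          exact sub_self _
        have h2 : X c ≤ resample v (fun c => Real.exp ((f c - resample v f c) ^ 2)) c :=
          expect_exp_le_expect_exp_sq _ h1
        have h3 := convexOn_map_resample_le (convexOn_rpow hN1) v
          (fun c => Real.exp ((f c - resample v f c) ^ 2)) (fun c => (Real.exp_pos _).le) c
        rw [mul_comm, ← Real.rpow_def_of_pos (hXpos c)]
        refine (Real.rpow_le_rpow (hXpos c).le h2 (by linarith)).trans (h3.trans (le_of_eq ?_))
        congr 1
        funext c
        rw [← Real.exp_mul, mul_comm]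
      · simp only [if_neg (hne v hv)]
        refine (hN v hv N hN1).trans ?_
        rw [← expect_resample u (fun c => Real.exp (N * (f c - resample v f c) ^ 2))]
        refine expect_le_expect fun c _ => ?_
        -- Since averages over `u` and `v` commute, the increment of `resample u f` at `v` is an
        -- average of that of `f`, and Jensen removes the averaging.
        have hconv : ConvexOn ℝ Set.univ fun x : ℝ => Real.exp (N * x ^ 2) := by
          have h1 : ConvexOn ℝ Set.univ fun x : ℝ => N * x ^ 2 :=
            (even_two.convexOn_pow).smul (by linarith : (0 : ℝ) ≤ N)
          exact ⟨convex_univ, fun x hx y hy a b ha hb hab =>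
            (Real.exp_le_exp.2 (h1.2 hx hy ha hb hab)).trans
              (convexOn_exp.2 (Set.mem_univ _) (Set.mem_univ _) ha hb hab)⟩
        rw [resample_comm v u, ← resample_sub]
        exact convexOn_map_resample_le hconv u (fun c => f c - resample v f c)
          (fun _ => Set.mem_univ _) c

/-- An exponential Efron-Stein inequality. -/
theorem sq_expect_exp_half_le [Nonempty C] (f : (V → C) → ℝ) (w : V → ℝ)
    (hw : ∀ v, 0 < w v) (hw1 : ∑ v, w v = 1) :
    (𝔼 c, Real.exp ((f c - 𝔼 c, f c) / 2)) ^ 2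
      ≤ ∑ v, w v * 𝔼 c, Real.exp ((f c - resample v f c) ^ 2 / w v) := by
  obtain ⟨L, -, hexp, hN⟩ := exists_compensator univ f (fun x y h => by
    rw [funext fun i => h i (by simp)])
  have hw_le : ∀ v, w v ≤ 1 := fun v =>
    hw1 ▸ single_le_sum (fun v _ => (hw v).le) (mem_univ v)
  -- Cauchy-Schwarz separates the compensated exponential from exp(∑ L v); convexity with weights
  -- `w` then splits the latter into single-vertex terms.
  have h1 := expect_mul_sq_le_sq_mul_sq univ
    (fun c => Real.exp ((f c - 𝔼 c, f c - ∑ v, L v c) / 2))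
    (fun c => Real.exp ((∑ v, L v c) / 2))
  simp only [← Real.exp_add, ← Real.exp_nat_mul] at h1
  have e1 : ∀ c, (f c - 𝔼 c, f c - ∑ v, L v c) / 2 + (∑ v, L v c) / 2 = (f c - 𝔼 c, f c) / 2 :=
    fun c => by ring
  have e2 : ∀ x : ℝ, ((2 : ℕ) : ℝ) * (x / 2) = x := fun x => by push_cast; ring
  simp only [e1, e2] at h1
  have h2 : 𝔼 c, Real.exp (∑ v, L v c) ≤ ∑ v, w v * 𝔼 c, Real.exp ((w v)⁻¹ * L v c) := by
    calc 𝔼 c, Real.exp (∑ v, L v c) ≤ 𝔼 c, ∑ v, w v * Real.exp ((w v)⁻¹ * L v c) := by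
          refine expect_le_expect fun c _ => ?_
          have := convexOn_exp.map_sum_le (t := univ) (w := w) (p := fun v => (w v)⁻¹ * L v c)
            (fun v _ => (hw v).le) hw1 (fun _ _ => Set.mem_univ _)
          simp only [smul_eq_mul] at this
          refine le_trans (le_of_eq ?_) this
          congr 1
          exact sum_congr rfl fun v _ => (mul_inv_cancel_left₀ (hw v).ne' _).symm
      _ = _ := by
          rw [expect_sum_comm]
          exact sum_congr rfl fun v _ => (mul_expect _ _ _).symm
  have h3 : 0 ≤ 𝔼 c, Real.exp (∑ v, L v c) := expect_nonneg fun _ _ => (Real.exp_pos _).le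
  calc _ ≤ _ := h1
    _ ≤ 1 * 𝔼 c, Real.exp (∑ v, L v c) := mul_le_mul_of_nonneg_right hexp h3
    _ ≤ ∑ v, w v * 𝔼 c, Real.exp ((w v)⁻¹ * L v c) := by rwa [one_mul]
    _ ≤ _ := by
        refine sum_le_sum fun v _ => mul_le_mul_of_nonneg_left ?_ (hw v).le
        refine (hN v (mem_univ _) _ ((one_le_inv₀ (hw v)).2 (hw_le v))).trans (le_of_eq ?_)
        exact expect_congr rfl fun c _ => by rw [div_eq_inv_mul]

end Averaging

/-! ### From subgaussian bounds to exponential moments of squares. -/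

open MeasureTheory ProbabilityTheory in
/-- A subgaussian variable on a finite set has a bounded exponential square moment. -/
theorem expect_exp_mul_sq_le {ι : Type*} [Fintype ι] (h : ι → ℝ) {K s : ℝ}
    (hs : 0 ≤ s) (hsK : s * K ≤ 3 / 16)
    (hh : ∀ θ : ℝ, 𝔼 i, Real.exp (θ * h i) ≤ Real.exp (K * θ ^ 2)) :
    𝔼 i, Real.exp (s * h i ^ 2) ≤ 2 := by
  have hmgf : ∀ a : ℝ, ∫ x, Real.exp (a * x) ∂(gaussianReal 0 1) = Real.exp (a ^ 2 / 2) := by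
    intro a
    have := congrFun (mgf_id_gaussianReal (μ := 0) (v := 1)) a
    simpa [mgf] using this
  have hint : ∀ a : ℝ, Integrable (fun x => Real.exp (a * x)) (gaussianReal 0 1) :=
    fun a => integrable_exp_mul_gaussianReal a
  have hpt : ∀ x : ℝ, gaussianPDFReal 0 1 x • Real.exp (3 / 8 * x ^ 2)
      = (√(2 * Real.pi))⁻¹ * Real.exp (-(1 / 8) * x ^ 2) := by
    intro x
    rw [gaussianPDFReal_def, smul_eq_mul]
    simp only [NNReal.coe_one, mul_one, sub_zero]
    rw [mul_assoc, ← Real.exp_add]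
    congr 2
    ring
  -- The value is 1/√(1 - 3/4); the bound s·K ≤ 3/16 is chosen so that 2sK ≤ 3/8.
  have hsq : ∫ x, Real.exp (3 / 8 * x ^ 2) ∂(gaussianReal 0 1) = 2 := by
    rw [integral_gaussianReal_eq_integral_smul one_ne_zero]
    simp only [hpt]
    have h8 : √(Real.pi / (1 / 8)) = 2 * √(2 * Real.pi) := by
      rw [show Real.pi / (1 / 8) = 2 ^ 2 * (2 * Real.pi) by ring,
        Real.sqrt_mul (by positivity) (2 * Real.pi), Real.sqrt_sq (by positivity)]
    rw [integral_const_mul, integral_gaussian, h8]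
    have : √(2 * Real.pi) ≠ 0 := (Real.sqrt_pos.2 (by positivity)).ne'
    field_simp
  have hsq_int : Integrable (fun x => Real.exp (3 / 8 * x ^ 2)) (gaussianReal 0 1) := by
    by_contra hcon
    rw [integral_undef hcon] at hsq
    norm_num at hsq
  -- An auxiliary Gaussian linearises the square, so that the bound on linear exponential moments
  -- applies for each value of the Gaussian.
  have e : ∀ i, Real.exp (s * h i ^ 2)
      = ∫ x, Real.exp (√(2 * s) * h i * x) ∂(gaussianReal 0 1) := by
    intro i
    rw [hmgf, mul_pow, Real.sq_sqrt (by positivity)]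
    congr 1
    ring
  simp only [e]
  rw [Fintype.expect_eq_sum_div_card, ← integral_finsetSum _ fun i _ => hint _,
    ← integral_div]
  refine (integral_mono ?_ hsq_int fun x => ?_).trans hsq.le
  · exact (integrable_finsetSum _ fun i _ => hint _).div_const _
  · simp only
    rw [← Fintype.expect_eq_sum_div_card]
    have := hh (√(2 * s) * x)
    refine le_trans (le_of_eq ?_) (this.trans (Real.exp_le_exp.2 ?_))
    · exact Finset.expect_congr rfl fun i _ => by congr 1; ring
    · rw [mul_pow, Real.sq_sqrt (by positivity)]
      nlinarith [sq_nonneg x]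

/-! ### Rainbow triples and their probability. -/

section Rainbow

open Finset Function

variable {V : Type*} {k : ℕ}

/-- The colours of `T` are pairwise different and congruent modulo `k`. -/
def IsRainbow (k : ℕ) (T : Finset V) (c : V → Fin (3 * k)) : Prop :=
  Set.InjOn c T ∧ ∀ u ∈ T, ∀ v ∈ T, (c u : ℕ) % k = (c v : ℕ) % k

open Classical in
/-- The indicator function of `IsRainbow`. -/
noncomputable def rainbowIndicator (k : ℕ) (T : Finset V) (c : V → Fin (3 * k)) : ℝ :=
  if IsRainbow k T c then 1 else 0

theorem rainbowIndicator_nonneg (T : Finset V) (c : V → Fin (3 * k)) :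
    0 ≤ rainbowIndicator k T c := by
  unfold rainbowIndicator
  split_ifs <;> norm_num

theorem rainbowIndicator_le_one (T : Finset V) (c : V → Fin (3 * k)) :
    rainbowIndicator k T c ≤ 1 := by
  unfold rainbowIndicator
  split_ifs <;> norm_num

theorem isRainbow_congr {T : Finset V} {c c' : V → Fin (3 * k)} (h : ∀ v ∈ T, c v = c' v) :
    IsRainbow k T c ↔ IsRainbow k T c' := by
  unfold IsRainbow
  refine and_congr (Set.EqOn.injOn_iff h) ?_
  exact forall₂_congr fun u hu => forall₂_congr fun v hv => by rw [h u hu, h v hv]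

theorem rainbowIndicator_update [DecidableEq V] {T : Finset V} {v : V} (hv : v ∉ T)
    (c : V → Fin (3 * k)) (j : Fin (3 * k)) :
    rainbowIndicator k T (update c v j) = rainbowIndicator k T c := by
  unfold rainbowIndicator
  rw [isRainbow_congr fun u hu => update_of_ne (ne_of_mem_of_not_mem hu hv) _ _]

theorem mod_eq_iff_of_lt_three_mul {i x : ℕ} (hi : i < k) (hx : x < 3 * k) :
    x % k = i ↔ x = i ∨ x = k + i ∨ x = 2 * k + i := by
  constructor
  · rintro rfl
    have h1 := Nat.div_add_mod x k
    have h2 : x / k < 3 := Nat.div_lt_of_lt_mul (by rwa [mul_comm])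
    generalize x / k = q at *
    generalize x % k = r at *
    interval_cases q <;> omega
  · rintro (rfl | rfl | rfl) <;> simp [Nat.mod_eq_of_lt hi]

theorem card_filter_mod_eq (hk : 1 ≤ k) (r : ℕ) (hr : r < k) :
    #{x : Fin (3 * k) | (x : ℕ) % k = r} = 3 := by
  have h : (univ.filter fun x : Fin (3 * k) => (x : ℕ) % k = r)
      = {⟨r, by omega⟩, ⟨k + r, by omega⟩, ⟨2 * k + r, by omega⟩} := by
    ext x
    simp only [mem_filter, mem_univ, true_and, mem_insert, mem_singleton, Fin.ext_iff]
    exact mod_eq_iff_of_lt_three_mul hr x.2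
  rw [h, card_eq_three]
  refine ⟨_, _, _, ?_, ?_, ?_, rfl⟩ <;> simp only [ne_eq, Fin.ext_iff] <;> omega

/-- Once `v` has colour `j`, the other two vertices must take the two remaining colours of that
residue class in either order: 2 of (3k)² choices. Independence of `j` is what centres
`rainbowDeviation`. -/
theorem expect_rainbowIndicator_update [Fintype V] [DecidableEq V] (hk : 1 ≤ k) {T : Finset V}
    (hT : #T = 3) {v : V} (hv : v ∈ T) (j : Fin (3 * k)) :
    𝔼 c, rainbowIndicator k T (update c v j) = 2 / (9 * (k : ℝ) ^ 2) := by
  have : Nonempty (Fin (3 * k)) := ⟨j⟩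
  have hT' : #(T.erase v) = 2 := by rw [card_erase_of_mem hv, hT]
  obtain ⟨a, b, hab, hTe⟩ := card_eq_two.1 hT'
  have hTeq : T = {v, a, b} := by rw [← insert_erase hv, hTe]
  have hav : a ≠ v := by
    have : a ∈ T.erase v := by simp [hTe]
    exact ne_of_mem_erase this
  have hbv : b ≠ v := by
    have : b ∈ T.erase v := by simp [hTe]
    exact ne_of_mem_erase this
  set R : Finset (Fin (3 * k)) := {x | (x : ℕ) % k = j % k} with hR
  have hRc : #(R.erase j) = 2 := by
    rw [card_erase_of_mem (by simp [hR]), hR, card_filter_mod_eq hk _ (Nat.mod_lt _ hk)]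
  have hiff : ∀ (c : V → Fin (3 * k)) (x y : Fin (3 * k)),
      IsRainbow k T (update (update (update c a x) b y) v j) ↔ (x, y) ∈ (R.erase j).offDiag := by
    intro c x y
    have e1 : update (update (update c a x) b y) v j a = x := by
      rw [update_of_ne hav, update_of_ne hab, update_self]
    have e2 : update (update (update c a x) b y) v j b = y := by
      rw [update_of_ne hbv, update_self]
    have e3 : update (update (update c a x) b y) v j v = j := update_self ..
    generalize update (update (update c a x) b y) v j = c' at *
    subst e1 e2 e3
    have hinj : Set.InjOn c' T ↔ c' v ≠ c' a ∧ c' v ≠ c' b ∧ c' a ≠ c' b := by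
      rw [hTeq]
      simp only [coe_insert, coe_singleton]
      rw [Set.injOn_insert (by simp [hav.symm, hbv.symm]), Set.injOn_insert (by simpa using hab)]
      simp [eq_comm]
      tauto
    rw [IsRainbow, hinj, hTeq]
    simp only [mem_insert, mem_singleton, forall_eq_or_imp, forall_eq, mem_offDiag, mem_erase, hR,
      mem_filter, mem_univ, true_and]
    grind
  have hval : ∀ c : V → Fin (3 * k),
      resample a (resample b fun c => rainbowIndicator k T (update c v j)) c
        = 2 / (9 * (k : ℝ) ^ 2) := by
    intro c
    simp only [resample, rainbowIndicator, hiff]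
    rw [← expect_product' univ univ fun x y : Fin (3 * k) =>
      if (x, y) ∈ (R.erase j).offDiag then (1 : ℝ) else 0]
    simp only [Prod.mk.eta, univ_product_univ]
    rw [Fintype.expect_eq_sum_div_card, sum_boole]
    simp only [filter_univ_mem, offDiag_card, hRc, Fintype.card_prod, Fintype.card_fin]
    push_cast
    ring
  rw [← expect_resample b, ← expect_resample a, expect_congr rfl fun c _ => hval c,
    Fintype.expect_const]

end Rainbow

/-! ### Concentration of the number of rainbow triples. -/

section Concentration

open Finset Function

variable {V : Type*} [DecidableEq V] {k : ℕ}

/-- The number of triples of `H` that contain `v`, coloured by `c` after recolouring `v` by `j`,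
minus its average over the colour of `v`. -/
noncomputable def rainbowDeviation (k : ℕ) (H : Finset (Finset V)) (v : V) (j : Fin (3 * k))
    (c : V → Fin (3 * k)) : ℝ :=
  ∑ T ∈ H with v ∈ T,
    (rainbowIndicator k T (update c v j) - resample v (rainbowIndicator k T) c)

theorem rainbowDeviation_update_self (H : Finset (Finset V)) (v : V) (i j : Fin (3 * k))
    (c : V → Fin (3 * k)) :
    rainbowDeviation k H v j (update c v i) = rainbowDeviation k H v j c := by
  simp [rainbowDeviation, resample_update]

theorem sum_sub_resample_eq_rainbowDeviation (hk : 1 ≤ k) (H : Finset (Finset V)) (v : V)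
    (c : V → Fin (3 * k)) :
    ∑ T ∈ H, rainbowIndicator k T c - resample v (fun c => ∑ T ∈ H, rainbowIndicator k T c) c
      = rainbowDeviation k H v (c v) c := by
  have : Nonempty (Fin (3 * k)) := ⟨⟨0, by omega⟩⟩
  rw [resample_sum, ← sum_sub_distrib, rainbowDeviation, update_eq_self, sum_filter]
  refine sum_congr rfl fun T _ => ?_
  split_ifs with h
  · rfl
  · rw [resample_of_update_eq fun c j => rainbowIndicator_update h c j, sub_self]

/-- Only triples through both `a` and `v` react to the colour of `a`, and each contributes a summand
lying in [-1, 1]. -/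
theorem abs_rainbowDeviation_update_sub_le (H : Finset (Finset V)) {a v : V}
    (hav : a ≠ v) (i j : Fin (3 * k)) (c : V → Fin (3 * k)) :
    |rainbowDeviation k H v j (update c a i) - rainbowDeviation k H v j c|
      ≤ 2 * #{T ∈ H | v ∈ T ∧ a ∈ T} := by
  have : Nonempty (Fin (3 * k)) := ⟨j⟩
  rw [rainbowDeviation, rainbowDeviation, ← sum_sub_distrib, ← filter_filter, card_eq_sum_ones,
    sum_filter (fun T => a ∈ T)]
  push_cast
  rw [mul_sum]
  refine (abs_sum_le_sum_abs _ _).trans (sum_le_sum fun T _ => ?_)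
  split_ifs with h
  · have hr : ∀ c, resample v (rainbowIndicator k T) c ∈ Set.Icc (0 : ℝ) 1 := fun c =>
      ⟨expect_nonneg fun _ _ => rainbowIndicator_nonneg _ _,
        expect_le univ_nonempty fun _ _ => rainbowIndicator_le_one _ _⟩
    have h1 := hr (update c a i)
    have h2 := hr c
    have h3 := rainbowIndicator_nonneg T (update (update c a i) v j)
    have h4 := rainbowIndicator_nonneg T (update c v j)
    have h5 := rainbowIndicator_le_one T (update (update c a i) v j)
    have h6 := rainbowIndicator_le_one T (update c v j)
    rw [abs_le]
    constructor <;> linarith [h1.1, h1.2, h2.1, h2.2]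
  · have h1 : rainbowIndicator k T (update (update c a i) v j)
        = rainbowIndicator k T (update c v j) := by
      rw [update_comm hav, rainbowIndicator_update h]
    have h2 : resample v (rainbowIndicator k T) (update c a i)
        = resample v (rainbowIndicator k T) c := by
      refine expect_congr rfl fun j _ => ?_
      rw [update_comm hav, rainbowIndicator_update h]
    simp [h1, h2]

variable [Fintype V]

theorem expect_rainbowDeviation (hk : 1 ≤ k) {H : Finset (Finset V)} (hH : ∀ T ∈ H, #T = 3)
    (v : V) (j : Fin (3 * k)) : 𝔼 c, rainbowDeviation k H v j c = 0 := by
  have : Nonempty (Fin (3 * k)) := ⟨j⟩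
  simp only [rainbowDeviation]
  rw [expect_sum_comm]
  refine sum_eq_zero fun T hT => ?_
  obtain ⟨hTH, hv⟩ := mem_filter.1 hT
  have h := fun j => expect_rainbowIndicator_update hk (hH T hTH) hv j
  rw [expect_sub_distrib, h]
  simp only [resample]
  rw [expect_comm, expect_congr rfl fun j _ => h j, Fintype.expect_const, sub_self]

/-- Bound one codegree factor by `d`; the codegrees sum to twice the degree, as each triple at `v`
has two other vertices. -/
theorem sum_sq_codegree_le {H : Finset (Finset V)} (hH : ∀ T ∈ H, #T = 3) {d : ℕ}
    (hd : ∀ u v, u ≠ v → #{T ∈ H | u ∈ T ∧ v ∈ T} ≤ d) (v : V) :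
    ∑ a, (if a = v then (0 : ℝ) else 2 * #{T ∈ H | v ∈ T ∧ a ∈ T}) ^ 2
      ≤ 8 * d * #{T ∈ H | v ∈ T} := by
  have hcount : ∑ a ∈ univ.erase v, #{T ∈ H | v ∈ T ∧ a ∈ T} = 2 * #{T ∈ H | v ∈ T} := by
    simp_rw [← filter_filter, card_filter (fun T => _ ∈ T)]
    rw [sum_comm, mul_comm, ← card_filter, ← smul_eq_mul, ← sum_const]
    refine sum_congr rfl fun T hT => ?_
    obtain ⟨hTH, hv⟩ := mem_filter.1 hT
    rw [← card_filter, show (univ.erase v).filter (· ∈ T) = T.erase v by ext; simp,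
      card_erase_of_mem hv, hH T hTH]
  have h : ∀ a, (if a = v then (0 : ℝ) else 2 * #{T ∈ H | v ∈ T ∧ a ∈ T}) ^ 2
      ≤ if a = v then 0 else 4 * d * (#{T ∈ H | v ∈ T ∧ a ∈ T} : ℝ) := by
    intro a
    split_ifs with hav
    · norm_num
    · have : (#{T ∈ H | v ∈ T ∧ a ∈ T} : ℝ) ≤ d := by exact_mod_cast hd v a (Ne.symm hav)
      nlinarith [Nat.cast_nonneg (α := ℝ) #{T ∈ H | v ∈ T ∧ a ∈ T}]
  refine (sum_le_sum fun a _ => h a).trans (le_of_eq ?_)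
  rw [← add_sum_erase _ _ (mem_univ v), if_pos rfl, zero_add,
    sum_congr rfl fun a ha => if_neg (ne_of_mem_erase ha), ← mul_sum, ← Nat.cast_sum, hcount]
  push_cast
  ring

theorem expect_exp_mul_rainbowDeviation_le (hk : 1 ≤ k) {H : Finset (Finset V)}
    (hH : ∀ T ∈ H, #T = 3) {d : ℕ} (hd : ∀ u v, u ≠ v → #{T ∈ H | u ∈ T ∧ v ∈ T} ≤ d) (v : V)
    (j : Fin (3 * k)) (θ : ℝ) :
    𝔼 c, Real.exp (θ * rainbowDeviation k H v j c)
      ≤ Real.exp (8 * d * #{T ∈ H | v ∈ T} * θ ^ 2) := by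
  have : Nonempty (Fin (3 * k)) := ⟨j⟩
  have h := expect_exp_le_of_dependsOn
    (fun a => |θ| * (if a = v then (0 : ℝ) else 2 * #{T ∈ H | v ∈ T ∧ a ∈ T})) univ
    (fun c => θ * rainbowDeviation k H v j c)
    (fun x y h => by rw [funext fun i => h i (by simp)])
    (fun a _ c i => by
      rw [← mul_sub, abs_mul]
      refine mul_le_mul_of_nonneg_left ?_ (abs_nonneg _)
      split_ifs with hav
      · rw [hav, rainbowDeviation_update_self, sub_self, abs_zero]
      · exact abs_rainbowDeviation_update_sub_le H hav i j c)
  rw [← mul_expect, expect_rainbowDeviation hk hH, mul_zero, zero_add] at h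
  refine h.trans (Real.exp_le_exp.2 ?_)
  simp_rw [mul_pow, sq_abs]
  rw [← mul_sum, mul_comm]
  exact mul_le_mul_of_nonneg_right (sum_sq_codegree_le hH hd v) (sq_nonneg θ)

theorem expect_sum_rainbowIndicator (hk : 1 ≤ k) {H : Finset (Finset V)}
    (hH : ∀ T ∈ H, #T = 3) :
    𝔼 c, ∑ T ∈ H, rainbowIndicator k T c = #H * (2 / (9 * (k : ℝ) ^ 2)) := by
  have : Nonempty (Fin (3 * k)) := ⟨⟨0, by omega⟩⟩
  rw [expect_sum_comm, ← nsmul_eq_mul, ← sum_const]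
  refine sum_congr rfl fun T hT => ?_
  obtain ⟨v, hv⟩ : T.Nonempty := card_pos.1 (by rw [hH T hT]; norm_num)
  rw [← expect_resample v]
  simp only [resample]
  rw [expect_comm, expect_congr rfl fun j _ =>
    expect_rainbowIndicator_update hk (hH T hT) hv j, Fintype.expect_const]

theorem expect_exp_half_sum_rainbowIndicator_le (hk : 1 ≤ k) {H : Finset (Finset V)}
    (hH : ∀ T ∈ H, #T = 3) (hne : H.Nonempty) {d : ℕ}
    (hd : ∀ u v, u ≠ v → #{T ∈ H | u ∈ T ∧ v ∈ T} ≤ d) {θ : ℝ}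
    (hθ : 256 * (d * #H) * θ ^ 2 ≤ 1) :
    𝔼 c, Real.exp (θ * (∑ T ∈ H, rainbowIndicator k T c - #H * (2 / (9 * (k : ℝ) ^ 2))) / 2)
      ≤ 3 / 2 := by
  have : Nonempty (Fin (3 * k)) := ⟨⟨0, by omega⟩⟩
  obtain ⟨T₀, hT₀⟩ := hne
  obtain ⟨v₀, -⟩ : T₀.Nonempty := card_pos.1 (by rw [hH T₀ hT₀]; norm_num)
  have hn : (0 : ℝ) < Fintype.card V := by exact_mod_cast Fintype.card_pos_iff.2 ⟨v₀⟩
  have ht : (0 : ℝ) < #H := by exact_mod_cast card_pos.2 ⟨T₀, hT₀⟩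
  -- Half the mass is uniform, keeping weights positive on vertices in no triple; the other half is
  -- proportional to degree, the degrees summing to 3·#H.
  set w : V → ℝ := fun v => (2 * (Fintype.card V : ℝ))⁻¹ + #{T ∈ H | v ∈ T} / (6 * #H) with hw
  have hwpos : ∀ v, 0 < w v := fun v => by positivity
  have hdeg : ∑ v, (#{T ∈ H | v ∈ T} : ℝ) = 3 * #H := by
    rw [← Nat.cast_sum]
    simp_rw [card_filter]
    rw [sum_comm]
    simp_rw [← card_filter, filter_univ_mem]
    rw [sum_congr rfl hH]
    simp [mul_comm]
  have hw1 : ∑ v, w v = 1 := by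
    rw [hw, sum_add_distrib, ← sum_div, hdeg, sum_const, card_univ, nsmul_eq_mul]
    field_simp
    norm_num
  have hE := expect_sum_rainbowIndicator hk hH
  have key := sq_expect_exp_half_le (fun c => θ * ∑ T ∈ H, rainbowIndicator k T c) w hwpos hw1
  rw [← mul_expect, hE] at key
  simp only [resample_const_mul, ← mul_sub] at key
  have hbound : ∀ v, 𝔼 c, Real.exp ((θ * (∑ T ∈ H, rainbowIndicator k T c
      - resample v (fun c => ∑ T ∈ H, rainbowIndicator k T c) c)) ^ 2 / w v) ≤ 2 := by
    intro v
    -- Fix the new colour `j` of `v` and average over the rest, where the deviation is subgaussian.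
    rw [← expect_resample v]
    simp only [resample]
    rw [expect_comm]
    refine expect_le univ_nonempty fun j _ => ?_
    refine le_trans (le_of_eq ?_) (expect_exp_mul_sq_le (rainbowDeviation k H v j)
      (s := θ ^ 2 / w v) (div_nonneg (sq_nonneg _) (hwpos v).le) ?_
      (expect_exp_mul_rainbowDeviation_le hk hH hd v j))
    · refine expect_congr rfl fun c _ => ?_
      have h := sum_sub_resample_eq_rainbowDeviation hk H v (update c v j)
      rw [update_self, rainbowDeviation_update_self] at h
      rw [← h, mul_pow, mul_div_right_comm]
      rfl
    · rw [div_mul_eq_mul_div, div_le_iff₀ (hwpos v)]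
      have h1 : (#{T ∈ H | v ∈ T} : ℝ) ≤ 6 * #H * w v := by
        have : 6 * (#H : ℝ) * w v
            = 6 * #H * (2 * (Fintype.card V : ℝ))⁻¹ + #{T ∈ H | v ∈ T} := by
          rw [hw]
          field_simp
        rw [this]
        have : 0 ≤ 6 * (#H : ℝ) * (2 * (Fintype.card V : ℝ))⁻¹ := by positivity
        linarith
      calc θ ^ 2 * (8 * d * #{T ∈ H | v ∈ T}) ≤ θ ^ 2 * (8 * d * (6 * #H * w v)) := by gcongr
        _ = 3 / 16 * (256 * (d * #H) * θ ^ 2) * w v := by ring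
        _ ≤ 3 / 16 * 1 * w v := by
          have := (hwpos v).le
          gcongr
        _ = 3 / 16 * w v := by ring
  have h2 := key.trans ((sum_le_sum fun v _ =>
    mul_le_mul_of_nonneg_left (hbound v) (hwpos v).le).trans_eq (by rw [← sum_mul, hw1, one_mul]))
  refine le_of_sq_le_sq ?_ (by norm_num)
  exact h2.trans (by norm_num)

theorem expect_indicator_lt_abs_le (hk : 1 ≤ k) {H : Finset (Finset V)}
    (hH : ∀ T ∈ H, #T = 3) (hne : H.Nonempty) {d : ℕ} (hd0 : 1 ≤ d)
    (hd : ∀ u v, u ≠ v → #{T ∈ H | u ∈ T ∧ v ∈ T} ≤ d) (lam : ℝ) :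
    𝔼 c, Set.indicator {c : V → Fin (3 * k) |
        lam < |∑ T ∈ H, rainbowIndicator k T c - #H * (2 / (9 * (k : ℝ) ^ 2))|}
        (1 : (V → Fin (3 * k)) → ℝ) c
      ≤ 3 * Real.exp (-(lam / (32 * √(d * #H)))) := by
  have ht : (0 : ℝ) < #H := by exact_mod_cast card_pos.2 hne
  have hd1 : (0 : ℝ) < d := by exact_mod_cast hd0
  have hs : 0 < √((d : ℝ) * #H) := Real.sqrt_pos.2 (by positivity)
  -- The largest value allowed by 256·d·#H·θ² ≤ 1.
  set θ : ℝ := 1 / (16 * √(d * #H)) with hθ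
  have hθpos : 0 < θ := by positivity
  have hθsq : 256 * ((d : ℝ) * #H) * θ ^ 2 ≤ 1 := by
    rw [hθ, div_pow, mul_pow, Real.sq_sqrt (by positivity)]
    apply le_of_eq
    field_simp
    norm_num
  have hp := expect_exp_half_sum_rainbowIndicator_le hk hH hne hd hθsq
  have hm := expect_exp_half_sum_rainbowIndicator_le hk hH hne hd (θ := -θ) (by rwa [neg_sq])
  set Z : (V → Fin (3 * k)) → ℝ := fun c =>
    ∑ T ∈ H, rainbowIndicator k T c - #H * (2 / (9 * (k : ℝ) ^ 2)) with hZ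
  have hexp : -(lam / (32 * √(d * #H))) = -(θ * lam / 2) := by
    rw [hθ]
    field_simp
    ring
  have hpt : ∀ c, Set.indicator {c | lam < |Z c|} (1 : (V → Fin (3 * k)) → ℝ) c
      ≤ Real.exp (-(θ * lam / 2)) * (Real.exp (θ * Z c / 2) + Real.exp (-θ * Z c / 2)) := by
    intro c
    by_cases hc : lam < |Z c|
    · rw [Set.indicator_of_mem (s := {c | lam < |Z c|}) hc, Pi.one_apply, mul_add,
        ← Real.exp_add, ← Real.exp_add]
      rcases lt_abs.1 hc with h | h
      · have : 1 ≤ Real.exp (-(θ * lam / 2) + θ * Z c / 2) := Real.one_le_exp (by nlinarith)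
        linarith [Real.exp_pos (-(θ * lam / 2) + -θ * Z c / 2)]
      · have : 1 ≤ Real.exp (-(θ * lam / 2) + -θ * Z c / 2) := Real.one_le_exp (by nlinarith)
        linarith [Real.exp_pos (-(θ * lam / 2) + θ * Z c / 2)]
    · rw [Set.indicator_of_notMem (s := {c | lam < |Z c|}) hc]
      positivity
  rw [hexp]
  refine (expect_le_expect fun c _ => hpt c).trans ?_
  rw [← mul_expect, expect_add_distrib, mul_comm]
  exact mul_le_mul_of_nonneg_right (by linarith) (Real.exp_pos _).le

end Concentration

/-! ### Translation from graphs and the colouring measure to rainbow triples. -/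

section Graph

open Finset Function

/-- The triangles of a finite graph. -/
noncomputable def triangles {V : Type*} [Finite V] (G : SimpleGraph V) : Finset (Finset V) :=
  (Set.toFinite (G.cliqueSet 3)).toFinset

variable {V : Type*} {k : ℕ} (G : SimpleGraph V)

/-- The three classes together are the residue class of `i` modulo `k`, and deleting edges inside
classes forces distinct colours. -/
theorem mem_cliqueSet_tripartiteSubgraph_iff {i : ℕ} (hi : i < k) (c : V → Fin (3 * k))
    (T : Finset V) :
    T ∈ (tripartiteSubgraph G (colorClass c i) (colorClass c (k + i))
        (colorClass c (2 * k + i))).cliqueSet 3 ↔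
      T ∈ G.cliqueSet 3 ∧ Set.InjOn c T ∧ ∀ u ∈ T, (c u : ℕ) % k = i := by
  have hmod := fun u => mod_eq_iff_of_lt_three_mul hi (c u).2
  have hmem : ∀ u, u ∈ colorClass c i ∪ colorClass c (k + i) ∪ colorClass c (2 * k + i) ↔
      (c u : ℕ) % k = i := by
    intro u
    rw [hmod]
    simp [colorClass, or_assoc]
  simp only [SimpleGraph.mem_cliqueSet_iff, SimpleGraph.isNClique_iff, SimpleGraph.IsClique]
  constructor
  · rintro ⟨hcl, hT⟩
    have hres : ∀ u ∈ T, (c u : ℕ) % k = i := by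
      intro u hu
      obtain ⟨v, hv, hvu⟩ := exists_mem_ne (by omega : 1 < #T) u
      exact (hmem u).1 (hcl hu hv hvu.symm).2.1
    refine ⟨⟨fun u hu v hv huv => (hcl hu hv huv).1, hT⟩, fun u hu v hv huv => ?_, hres⟩
    by_contra hne
    obtain ⟨-, -, -, hA, hB, hC⟩ := hcl hu hv hne
    simp only [colorClass, Set.mem_ofPred_eq, huv, and_self] at hA hB hC
    rcases (hmod v).1 (hres v hv) with h | h | h <;> contradiction
  · rintro ⟨⟨hcl, hT⟩, hinj, hres⟩
    refine ⟨fun u hu v hv huv => ⟨hcl hu hv huv, (hmem u).2 (hres u hu), (hmem v).2 (hres v hv),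
      ?_, ?_, ?_⟩, hT⟩ <;>
    · rintro ⟨h1, h2⟩
      exact huv (hinj hu hv (Fin.ext (h1.trans h2.symm)))

variable [Finite V]

theorem mem_triangles {T : Finset V} : T ∈ triangles G ↔ T ∈ G.cliqueSet 3 := by
  simp [triangles]

theorem card_of_mem_triangles {T : Finset V} (hT : T ∈ triangles G) : #T = 3 :=
  ((mem_triangles G).1 hT).card_eq

theorem triangleCount_eq_card : triangleCount G = #(triangles G) :=
  Set.ncard_eq_toFinset_card _ _

theorem sparsifiedCount_eq_sum (hk : 1 ≤ k) (c : V → Fin (3 * k)) :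
    (sparsifiedCount G k c : ℝ) = ∑ T ∈ triangles G, rainbowIndicator k T c := by
  classical
  have h1 : ∀ i ∈ range k, tripartiteTriangleCount G (colorClass c i) (colorClass c (k + i))
      (colorClass c (2 * k + i))
      = ∑ T ∈ triangles G, if Set.InjOn c T ∧ ∀ u ∈ T, (c u : ℕ) % k = i then 1 else 0 := by
    intro i hi
    rw [← card_filter, ← Set.ncard_coe_finset, tripartiteTriangleCount, triangleCount]
    congr 1
    ext T
    rw [mem_cliqueSet_tripartiteSubgraph_iff G (mem_range.1 hi), mem_coe, mem_filter,
      mem_triangles]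
  rw [sparsifiedCount, sum_congr rfl h1, sum_comm]
  push_cast
  refine sum_congr rfl fun T hT => ?_
  obtain ⟨v, hv⟩ : T.Nonempty := card_pos.1 (by rw [card_of_mem_triangles G hT]; norm_num)
  -- Only the index equal to the residue of a vertex of `T` can contribute.
  rw [sum_eq_single_of_mem ((c v : ℕ) % k) (mem_range.2 (Nat.mod_lt _ hk))
    fun i _ hi => if_neg fun h => hi (h.2 v hv).symm, rainbowIndicator]
  congr 1
  refine propext (and_congr_right fun _ => ⟨fun h u hu w hw => ?_, fun h u hu => h u hu v hv⟩)
  rw [h u hu, h w hw]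

theorem card_triangles_filter_le [DecidableEq V] {d : ℕ} (hd : maxEdgeTriangleCount G ≤ d)
    (u v : V) (huv : u ≠ v) : #{T ∈ triangles G | u ∈ T ∧ v ∈ T} ≤ d := by
  by_cases hadj : G.Adj u v
  · refine le_trans (le_trans (le_of_eq ?_) (le_ciSup (Set.finite_range
      fun e : G.edgeSet => edgeTriangleCount G e).bddAbove ⟨s(u, v), hadj⟩)) hd
    rw [← Set.ncard_coe_finset, edgeTriangleCount]
    congr 1
    ext T
    simp [mem_triangles]
  · rw [filter_eq_empty_iff.2, card_empty]
    · exact Nat.zero_le _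
    · rintro T hT ⟨hu, hv⟩
      exact hadj (((mem_triangles G).1 hT).isClique hu hv huv)

omit [Finite V] in
theorem coloringMeasure_real_eq_expect [Fintype V] [DecidableEq V] {m : ℕ} (hm : 1 ≤ m)
    (S : Set (V → Fin m)) :
    (coloringMeasure V m).real S = 𝔼 c, S.indicator (1 : (V → Fin m) → ℝ) c := by
  have : Nonempty (Fin m) := ⟨⟨0, hm⟩⟩
  have hprob : MeasureTheory.IsProbabilityMeasure
      (ProbabilityTheory.uniformOn (Set.univ : Set (Fin m))) :=
    ProbabilityTheory.isProbabilityMeasure_uniformOn Set.finite_univ Set.univ_nonempty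
  have hprob' : MeasureTheory.IsProbabilityMeasure (coloringMeasure V m) := by
    unfold coloringMeasure
    infer_instance
  have hsing : ∀ c : V → Fin m,
      (coloringMeasure V m).real {c} = (Fintype.card (V → Fin m) : ℝ)⁻¹ := by
    intro c
    rw [MeasureTheory.measureReal_def, coloringMeasure, MeasureTheory.Measure.pi_singleton,
      ENNReal.toReal_prod]
    simp [ProbabilityTheory.uniformOn_univ]
  classical
  rw [← Set.coe_toFinset S, ← MeasureTheory.sum_measureReal_singleton,
    sum_congr rfl fun c _ => hsing c, sum_const, nsmul_eq_mul, Fintype.expect_eq_sum_div_card,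
    div_eq_mul_inv]
  congr 1
  simp [Set.indicator_apply, sum_boole]

end Graph

end TriangleSparsification

/-! ### The sparsification lemma. -/

theorem mainTheorem2 :
    ∃ κ₁ : ℝ, 0 < κ₁ ∧
      ∀ (k d : ℕ), 1 ≤ k →
        ∀ (V : Type*) [Fintype V] (G : SimpleGraph V),
          TriangleSparsification.maxEdgeTriangleCount G ≤ d →
          (TriangleSparsification.coloringMeasure V (3 * k)).real
              {c | |9 * (k : ℝ) ^ 2 / 2 * (TriangleSparsification.sparsifiedCount G k c : ℝ)
                      - (TriangleSparsification.triangleCount G : ℝ)|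
                    > κ₁ * (d : ℝ) * (k : ℝ) ^ 2
                        * Real.sqrt (TriangleSparsification.triangleCount G : ℝ)
                        * Real.log (Fintype.card V : ℝ)}
            ≤ 2 / (Fintype.card V : ℝ) ^ 4 := by
  -- 720 = (9/2)·160, and 160 = 5·32 makes the tail at most 3/n⁵.
  refine ⟨720, by norm_num, fun k d hk V _ G hd => ?_⟩
  classical
  have hcodeg := TriangleSparsification.card_triangles_filter_le G hd
  have hcard := fun T => TriangleSparsification.card_of_mem_triangles G (T := T)
  simp only [TriangleSparsification.sparsifiedCount_eq_sum G hk,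
    TriangleSparsification.triangleCount_eq_card]
  generalize TriangleSparsification.triangles G = H at hcodeg hcard
  -- Without triangles the event reads 0 > 0. One triangle gives `1 ≤ d` and n ≥ 2, the latter
  -- turning 3/n⁵ into at most 2/n⁴.
  rcases H.eq_empty_or_nonempty with rfl | hne
  · simp only [Finset.sum_empty, Finset.card_empty, Nat.cast_zero, mul_zero, sub_zero, abs_zero,
      Real.sqrt_zero, zero_mul, gt_iff_lt, lt_irrefl]
    simp only [Set.ofPred_false, MeasureTheory.measureReal_empty]
    positivity
  obtain ⟨T, hT⟩ := hne
  obtain ⟨u, v, w, huv, -, -, rfl⟩ := Finset.card_eq_three.1 (hcard T hT)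
  have hd1 : 1 ≤ d := (Finset.card_pos.2 ⟨_, Finset.mem_filter.2 ⟨hT, by simp, by simp⟩⟩).trans_le
    (hcodeg u v huv)
  have hn : 2 ≤ Fintype.card V := Fintype.one_lt_card_iff.2 ⟨u, v, huv⟩
  have hk0 : (0 : ℝ) < k := by exact_mod_cast hk
  have hd0 : (1 : ℝ) ≤ d := by exact_mod_cast hd1
  have ht0 : (0 : ℝ) < H.card := by exact_mod_cast Finset.card_pos.2 ⟨_, hT⟩
  have hn2 : (2 : ℝ) ≤ Fintype.card V := by exact_mod_cast hn
  set n : ℝ := (Fintype.card V : ℝ)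
  have hlog : 0 ≤ Real.log n := Real.log_nonneg (by linarith)
  set lam : ℝ := 160 * d * √(H.card : ℝ) * Real.log n with hlam
  have hset : {c : V → Fin (3 * k) | |9 * (k : ℝ) ^ 2 / 2
        * ∑ T ∈ H, TriangleSparsification.rainbowIndicator k T c - (H.card : ℝ)|
        > 720 * (d : ℝ) * (k : ℝ) ^ 2 * √(H.card : ℝ) * Real.log n}
      = {c | lam < |∑ T ∈ H, TriangleSparsification.rainbowIndicator k T c
        - H.card * (2 / (9 * (k : ℝ) ^ 2))|} := by
    ext c
    have hc : 9 * (k : ℝ) ^ 2 / 2 * ∑ T ∈ H, TriangleSparsification.rainbowIndicator k T c - H.card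
        = 9 * (k : ℝ) ^ 2 / 2 * (∑ T ∈ H, TriangleSparsification.rainbowIndicator k T c
          - H.card * (2 / (9 * (k : ℝ) ^ 2))) := by
      field_simp
    have hl : 720 * (d : ℝ) * (k : ℝ) ^ 2 * √(H.card : ℝ) * Real.log n
        = 9 * (k : ℝ) ^ 2 / 2 * lam := by
      rw [hlam]
      ring
    have hpos : 0 < 9 * (k : ℝ) ^ 2 / 2 := by positivity
    simp only [Set.mem_ofPred_eq]
    rw [hc, hl, abs_mul, abs_of_pos hpos, gt_iff_lt, mul_lt_mul_iff_right₀ hpos]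
  rw [hset, TriangleSparsification.coloringMeasure_real_eq_expect (by omega)]
  refine (TriangleSparsification.expect_indicator_lt_abs_le hk hcard ⟨_, hT⟩ hd1 hcodeg
    lam).trans ?_
  have hexp : 5 * Real.log n ≤ lam / (32 * √((d : ℝ) * H.card)) := by
    have hs : √(d : ℝ) ≤ d := Real.sqrt_le_iff.2 ⟨by linarith, by nlinarith⟩
    rw [hlam, Real.sqrt_mul (by linarith), le_div_iff₀ (by positivity)]
    calc 5 * Real.log n * (32 * (√(d : ℝ) * √(H.card : ℝ)))
        = 160 * √(d : ℝ) * √(H.card : ℝ) * Real.log n := by ring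
      _ ≤ 160 * d * √(H.card : ℝ) * Real.log n := by gcongr
  calc 3 * Real.exp (-(lam / (32 * √((d : ℝ) * H.card))))
      ≤ 3 * Real.exp (-(5 * Real.log n)) := by gcongr
    _ = 3 / n ^ 5 := by
        rw [Real.exp_neg, show (5 : ℝ) * Real.log n = ((5 : ℕ) : ℝ) * Real.log n by norm_num,
          Real.exp_nat_mul, Real.exp_log (by linarith), div_eq_mul_inv]
    _ ≤ 2 / n ^ 4 := by
        rw [div_le_div_iff₀ (by positivity) (by positivity)]
        have : 0 < n ^ 4 := by positivity
        nlinarith
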